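/- Let $n$ agents $\mathcal N=\{1,\dots,n\}$ be matched to $n$ items, each agent receiving exactly one item, where agent $i$ has an arbitrary real value $v_i(j)$ for item $j$. The alternatives are the permutations $\sigma$ of $\{1,\dots,n\}$; under $\sigma$ agent $i$ receives item $\sigma(i)$ and has value $v_i(\sigma(i))$. For $S\subseteq\mathcal N$ let $$W_{\max}(S)=\max_{\sigma}\sum_{i\in S}v_i(\sigma(i)),$$ that is, the maximum weight of a matching of all agents of $S$ to distinct items. Let $\pi$ be any probability distribution over the alternatives (the disagreement point), and let $d_i=\sum_\sigma \pi(\sigma)v_i(\sigma(i))$. A solution $(\sigma^*,p)$ consists of an alternative $\sigma^*$ that maximizes $\sum_{i\in\mathcal N}v_i(\sigma(i))$ and of transfers $p\in\mathbb R^n$ with $\sum_i p_i=0$; its utilities are $u_i=v_i(\sigma^*(i))+p_i$, and solutions with the same utility vector are identified. The WS-core is the set of solutions with $u_i\ge d_i$ for every agent $i$ and $\sum_{i\in S}u_i\le W_{\max}(S)$ for every $S\subseteq\mathcal N$. The gain vector of a solution is $g=(u_i-d_i)_{i}$. For $x\in\mathbb R^n$ let $\hat x_1\le\dots\le\hat x_n$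 be its coordinates in nondecreasing order. A solution in the WS-core, with gain vector $g$, is called - Lorenz dominating, if for every solution in the WS-core, with gain vector $g'$, one has $\sum_i g_i=\sum_i g'_i$ and $\sum_{i=1}^k\hat g_i\ge\sum_{i=1}^k\hat g'_i$ for all $1\le k\le n$; - lexicographically maximal (lexmax-WS), if for every other solution in the WS-core, with gain vector $g'$, one has $\sum_i g_i=\sum_i g'_i$ and there is $1\le k<n$ with $\hat g_k>\hat g'_k$ and $\hat g_i=\hat g'_i$ for all $i<k$; - min-square, if it minimizes $\sum_i g_i^2$ over the WS-core. Proposition. The set function $W_{\max}$ is submodular: $W_{\max}(S)+W_{\max}(T)\ge W_{\max}(S\cap T)+W_{\max}(S\cup T)$ for all $S,T\subseteq\mathcal N$. Moreover, for every $\pi$, the WS-core contains a Lorenz dominating solution. This solution is unique (in terms of utilities), and it coincides with the (unique) lexicographically maximal solution and with the (unique) min-square solution. -/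

import Mathlib

namespace WelfareSharing

/-- A set function on finite sets of agents is submodular. -/
def IsSubmodular {N : Type*} [DecidableEq N] (f : Finset N → ℝ) : Prop :=
  ∀ S T : Finset N, f (S ∩ T) + f (S ∪ T) ≤ f S + f T

/-- `v i A` is the value of agent `i` for alternative `A`; `wmax v S` is the maximum welfare
that the set `S` of agents can derive from a single alternative. -/
noncomputable def wmax {n : ℕ} {Alt : Type*} [Fintype Alt] [Nonempty Alt]
    (v : Fin n → Alt → ℝ) (S : Finset (Fin n)) : ℝ :=
  (Finset.univ : Finset Alt).sup' Finset.univ_nonempty (fun A => ∑ i ∈ S, v i A)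

/-- The disagreement utility of agent `i`: its expected value under the distribution `π`. -/
def disagreement {n : ℕ} {Alt : Type*} [Fintype Alt]
    (v : Fin n → Alt → ℝ) (π : Alt → ℝ) (i : Fin n) : ℝ :=
  ∑ A, π A * v i A

/-- A solution: a welfare-maximizing alternative together with budget-balanced transfers. -/
structure Solution {n : ℕ} {Alt : Type*} (v : Fin n → Alt → ℝ) where
  alt : Alt
  transfer : Fin n → ℝ
  welfare_max : ∀ A : Alt, ∑ i, v i A ≤ ∑ i, v i alt
  budget_balanced : ∑ i, transfer i = 0

/-- The quasi-linear utility of agent `i` in a solution. -/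
def Solution.utility {n : ℕ} {Alt : Type*} {v : Fin n → Alt → ℝ} (s : Solution v)
    (i : Fin n) : ℝ :=
  v i s.alt + s.transfer i

/-- The welfare-sharing core: the solutions that satisfy the domination constraints and the
anticore constraints. -/
def wsCore {n : ℕ} {Alt : Type*} [Fintype Alt] [Nonempty Alt]
    (v : Fin n → Alt → ℝ) (π : Alt → ℝ) : Set (Solution v) :=
  {s | (∀ i, disagreement v π i ≤ s.utility i) ∧
    ∀ S : Finset (Fin n), ∑ i ∈ S, s.utility i ≤ wmax v S}

/-- Utility measured from the disagreement point, that is, the utility after each valuation has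
been shifted so that its expected value under `π` is zero. -/
def gain {n : ℕ} {Alt : Type*} [Fintype Alt] {v : Fin n → Alt → ℝ}
    (π : Alt → ℝ) (s : Solution v) (i : Fin n) : ℝ :=
  s.utility i - disagreement v π i

/-- The coordinates of `x` rearranged in nondecreasing order. -/
noncomputable def sorted {n : ℕ} (x : Fin n → ℝ) : Fin n → ℝ :=
  x ∘ Tuple.sort x

/-- `x` Lorenz-dominates `y`: the sums are equal and, for each `k`, the sum of the `k` smallest
coordinates of `x` is at least that of `y`. -/
def LorenzDominates {n : ℕ} (x y : Fin n → ℝ) : Prop :=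
  ∑ i, x i = ∑ i, y i ∧
    ∀ k : ℕ, 1 ≤ k → k ≤ n →
      ∑ i : Fin n with i.val < k, sorted y i ≤ ∑ i : Fin n with i.val < k, sorted x i

/-- The sums are equal and, at the first index where the nondecreasing rearrangements differ,
that of `x` is larger. Equality of the sums means that this index is not the last one. -/
def LexGreater {n : ℕ} (x y : Fin n → ℝ) : Prop :=
  ∑ i, x i = ∑ i, y i ∧
    ∃ k : Fin n, k.val + 1 < n ∧ sorted y k < sorted x k ∧ ∀ i < k, sorted x i = sorted y i

/-- A solution in the WS-core that Lorenz-dominates every solution in the WS-core. -/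
def IsLorenzDominating {n : ℕ} {Alt : Type*} [Fintype Alt] [Nonempty Alt]
    {v : Fin n → Alt → ℝ} (π : Alt → ℝ) (s : Solution v) : Prop :=
  s ∈ wsCore v π ∧ ∀ t ∈ wsCore v π, LorenzDominates (gain π s) (gain π t)

/-- The lexicographically maximal solution in the WS-core: it is lexicographically greater than
every other one, where solutions with the same utilities are identified. -/
def IsLexmaxWS {n : ℕ} {Alt : Type*} [Fintype Alt] [Nonempty Alt]
    {v : Fin n → Alt → ℝ} (π : Alt → ℝ) (s : Solution v) : Prop :=
  s ∈ wsCore v π ∧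
    ∀ t ∈ wsCore v π, t.utility ≠ s.utility → LexGreater (gain π s) (gain π t)

/-- A solution in the WS-core that minimizes the sum of the squares of the gains. -/
def IsMinSquare {n : ℕ} {Alt : Type*} [Fintype Alt] [Nonempty Alt]
    {v : Fin n → Alt → ℝ} (π : Alt → ℝ) (s : Solution v) : Prop :=
  s ∈ wsCore v π ∧ ∀ t ∈ wsCore v π, ∑ i, gain π s i ^ 2 ≤ ∑ i, gain π t i ^ 2

/-- Unit-demand matching of `n` agents and `n` items, where `val i j` is the value of agent `i`
for item `j`: the alternatives are the permutations, and `σ` gives item `σ i` to agent `i`. -/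
def unitDemand {n : ℕ} (val : Fin n → Fin n → ℝ) : Fin n → Equiv.Perm (Fin n) → ℝ :=
  fun i σ => val i (σ i)

end WelfareSharing

/-! Submodularity is an exchange argument: optimal matchings of `S ∩ T` and `S ∪ T` are swapped
along alternating paths to give matchings of `S` and `T` of the same total weight.

Put h(S) = W_max(S) − d(S). It is submodular, vanishes at `∅`, and is nonnegative because d averages
values of single alternatives. Gains of core solutions are exactly the points of the polymatroid of
h with total h(N). Minimizing a squared distance over this polymatroid gives a point g. If g i < g
j, mass cannot be moved from j to i, so some tight set contains i but not j; tight sets form a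
lattice, hence every lower level set L of g is tight (`exists_egalitarian_base`). For any core gain
x and level c this gives ∑ (c − g i)⁺ = c|L| − h(L) ≤ c|L| − x(L) ≤ ∑ (c − x i)⁺, which is Lorenz
dominance in dual form.

All three uniqueness claims reduce to strict convexity: vectors with equal rearrangements have equal
sums of squares, and only g attains the least one. -/

namespace WelfareSharing

open Finset

/-! ### Matchings and submodularity of the maximum weight. -/

section Matching

variable {n : ℕ} (val : Fin n → Fin n → ℝ)

lemma sum_le_wmax {Alt : Type*} [Fintype Alt] [Nonempty Alt] (v : Fin n → Alt → ℝ)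
    (S : Finset (Fin n)) (A : Alt) : ∑ i ∈ S, v i A ≤ wmax v S :=
  Finset.le_sup' (fun A => ∑ i ∈ S, v i A) (Finset.mem_univ A)

lemma exists_sum_eq_wmax {Alt : Type*} [Fintype Alt] [Nonempty Alt] (v : Fin n → Alt → ℝ)
    (S : Finset (Fin n)) : ∃ A : Alt, ∑ i ∈ S, v i A = wmax v S := by
  obtain ⟨A, -, hA⟩ := Finset.exists_mem_eq_sup' (Finset.univ_nonempty (α := Alt))
    (fun A => ∑ i ∈ S, v i A)
  exact ⟨A, hA.symm⟩

/-- A partial matching extends to a permutation. -/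
lemma exists_perm_eqOn (S : Finset (Fin n)) (f : Fin n → Fin n) (hf : Set.InjOn f S) :
    ∃ σ : Equiv.Perm (Fin n), ∀ i ∈ S, σ i = f i := by
  obtain ⟨σ, hσ⟩ := Finset.exists_equiv_extend_of_card_eq (t := (Finset.univ : Finset (Fin n)))
    (by simp) (s := S) (f := f) (by simp) hf
  refine ⟨σ.trans (Equiv.subtypeUnivEquiv (by simp)), fun i hi => ?_⟩
  simpa using hσ i hi

lemma sum_le_wmax_unitDemand (S : Finset (Fin n)) (f : Fin n → Fin n) (hf : Set.InjOn f S) :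
    ∑ i ∈ S, val i (f i) ≤ wmax (unitDemand val) S := by
  obtain ⟨σ, hσ⟩ := exists_perm_eqOn S f hf
  calc ∑ i ∈ S, val i (f i) = ∑ i ∈ S, unitDemand val i σ :=
        Finset.sum_congr rfl fun i hi => by simp [unitDemand, hσ i hi]
    _ ≤ _ := sum_le_wmax _ S σ

lemma isGreatest_wmax_unitDemand (S : Finset (Fin n)) :
    IsGreatest (Set.range fun f : S ↪ Fin n => ∑ i : S, val i (f i))
      (wmax (unitDemand val) S) := by
  constructor
  · obtain ⟨σ, hσ⟩ := exists_sum_eq_wmax (unitDemand val) S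
    refine ⟨(Function.Embedding.subtype _).trans σ.toEmbedding, ?_⟩
    rw [← hσ]
    exact Finset.sum_coe_sort S (fun i => val i (σ i))
  · rintro _ ⟨f, rfl⟩
    -- The value outside `S` is a filler.
    let g : Fin n → Fin n := fun i => if h : i ∈ S then f ⟨i, h⟩ else i
    have hg : ∀ i : S, g i = f i := fun i => by simp [g]
    have hinj : Set.InjOn g S := by
      intro i hi j hj hij
      have := (hg ⟨i, hi⟩).symm.trans (hij.trans (hg ⟨j, hj⟩))
      simpa using f.injective this
    have h := sum_le_wmax_unitDemand val S g hinj
    rw [← Finset.sum_coe_sort S (fun i => val i (g i))] at h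
    simpa [hg] using h

/-- The elements reached from `I` by iterating `ρ` as long as it stays inside `A`. -/
inductive Reach {N : Type*} (I A : Finset N) (ρ : N → N) : N → Prop
  | base {i : N} : i ∈ I → Reach I A ρ i
  | step {i : N} : Reach I A ρ i → ρ i ∈ A → Reach I A ρ (ρ i)

/-- Start at the agents of `S \ T` and follow alternating paths: from an agent to its `σ`-item, then
to the `τ`-owner of that item if that owner is in `S ∩ T`. On `S` reached agents use `σ` and the
others `τ`; on `T` the roles are reversed. A collision in `S` would extend a path to an unreached
agent; one in `T` would give a reached agent an unreached predecessor. -/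
theorem isSubmodular_wmax_unitDemand : IsSubmodular (wmax (unitDemand val)) := by
  classical
  intro S T
  obtain ⟨τ, hτ⟩ := exists_sum_eq_wmax (unitDemand val) (S ∩ T)
  obtain ⟨σ, hσ⟩ := exists_sum_eq_wmax (unitDemand val) (S ∪ T)
  set P : Fin n → Prop := Reach (S \ T) (S ∩ T) (fun i => τ.symm (σ i)) with hP
  have hout : ∀ p b, P p → b ∈ S ∩ T → σ p = τ b → P b := by
    intro p b hp hb h
    have e : τ.symm (σ p) = b := by rw [h]; simp
    have := Reach.step hp (by simpa [e] using hb)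
    simpa [e] using this
  have hin : ∀ a b, P a → a ∈ T → τ a = σ b → P b := by
    intro a b ha haT h
    cases ha with
    | base hi => exact absurd haT (Finset.mem_sdiff.1 hi).2
    | @step i hp _ =>
      have : σ b = σ i := by rw [← h]; exact τ.apply_symm_apply _
      rwa [σ.injective this]
  have hPS : ∀ a, P a → a ∈ S := by
    intro a ha
    cases ha with
    | base hi => exact (Finset.mem_sdiff.1 hi).1
    | step _ h => exact (Finset.mem_inter.1 h).1
  have hbase : ∀ a ∈ S, a ∉ T → P a := fun a h1 h2 => Reach.base (Finset.mem_sdiff.2 ⟨h1, h2⟩)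
  have h1 := sum_le_wmax_unitDemand val S (fun i => if P i then σ i else τ i) (by
    intro a ha b hb hab
    rw [Finset.mem_coe] at ha hb
    by_cases pa : P a <;> by_cases pb : P b <;> simp only [pa, pb, if_true, if_false] at hab
    · exact σ.injective hab
    · have hbT : b ∈ T := by by_contra h; exact pb (hbase b hb h)
      exact absurd (hout a b pa (Finset.mem_inter.2 ⟨hb, hbT⟩) hab) pb
    · have haT : a ∈ T := by by_contra h; exact pa (hbase a ha h)
      exact absurd (hout b a pb (Finset.mem_inter.2 ⟨ha, haT⟩) hab.symm) pa
    · exact τ.injective hab)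
  have h2 := sum_le_wmax_unitDemand val T (fun i => if P i then τ i else σ i) (by
    intro a ha b hb hab
    rw [Finset.mem_coe] at ha hb
    by_cases pa : P a <;> by_cases pb : P b <;> simp only [pa, pb, if_true, if_false] at hab
    · exact τ.injective hab
    · exact absurd (hin a b pa ha hab) pb
    · exact absurd (hin b a pb hb hab.symm) pa
    · exact σ.injective hab)
  -- The weights agree agent by agent: outside `S ∩ T` only `σ` is used, and inside it `σ` and `τ`
  -- are used once each.
  refine le_trans (le_of_eq ?_) (add_le_add h1 h2)
  rw [← hτ, ← hσ]
  simp only [unitDemand]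
  have key : ∀ R : Finset (Fin n), ∀ w : Fin n → ℝ, ∑ i ∈ R, w i = ∑ i, if i ∈ R then w i else 0 :=
    fun R w => by simp
  rw [key (S ∩ T), key (S ∪ T), key S, key T, ← Finset.sum_add_distrib, ← Finset.sum_add_distrib]
  refine Finset.sum_congr rfl fun i _ => ?_
  have b := hbase i
  have c := hPS i
  by_cases hS : i ∈ S <;> by_cases hT : i ∈ T <;> by_cases hp : P i <;>
    simp_all [add_comm]

end Matching

/-! ### Polymatroids, tight sets and the egalitarian base. -/

section Polymatroid

variable {N : Type*}

/-- The polymatroid of nonnegative vectors dominated by a set function. -/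
def polymatroid (h : Finset N → ℝ) : Set (N → ℝ) :=
  {g | (∀ i, 0 ≤ g i) ∧ ∀ S : Finset N, ∑ i ∈ S, g i ≤ h S}

lemma isCompact_polymatroid (h : Finset N → ℝ) : IsCompact (polymatroid h) := by
  refine IsCompact.of_isClosed_subset (s := Set.pi Set.univ fun i => Set.Icc 0 (h {i}))
    (isCompact_univ_pi fun i => isCompact_Icc) ?_ ?_
  · simp only [polymatroid, Set.ofPred_and, Set.ofPred_forall]
    refine IsClosed.inter (isClosed_iInter fun i => ?_) (isClosed_iInter fun S => ?_)
    · exact isClosed_le continuous_const (continuous_apply i)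
    · exact isClosed_le (by fun_prop) continuous_const
  · intro g hg i _
    exact ⟨hg.1 i, by simpa using hg.2 {i}⟩

/-- A direction that increases no tight constraint can be followed for a positive time. -/
lemma eventually_add_smul_mem_polymatroid [Fintype N] {h : Finset N → ℝ} {g : N → ℝ}
    (hg : g ∈ polymatroid h) {w : N → ℝ} (h0 : ∀ i, g i = 0 → 0 ≤ w i)
    (hw : ∀ S : Finset N, ∑ i ∈ S, g i = h S → ∑ i ∈ S, w i ≤ 0) :
    ∀ᶠ ε in nhdsWithin (0 : ℝ) (Set.Ioi 0), g + ε • w ∈ polymatroid h := by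
  have hpos : ∀ᶠ ε in nhdsWithin (0 : ℝ) (Set.Ioi 0), 0 < ε := eventually_mem_nhdsWithin
  have e1 : ∀ᶠ ε in nhdsWithin (0 : ℝ) (Set.Ioi 0), ∀ i, 0 ≤ (g + ε • w) i := by
    refine Filter.eventually_all.2 fun i => ?_
    rcases (hg.1 i).eq_or_lt with hi | hi
    · filter_upwards [hpos] with ε hε
      have := mul_nonneg hε.le (h0 i hi.symm)
      simpa [← hi] using this
    · have hc : Filter.Tendsto (fun ε : ℝ => g i + ε * w i) (nhdsWithin 0 (Set.Ioi 0))
          (nhds (g i + 0 * w i)) :=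
        ((by fun_prop : Continuous fun ε : ℝ => g i + ε * w i).tendsto 0).mono_left
          nhdsWithin_le_nhds
      filter_upwards [hc.eventually_const_lt (u := 0) (by simpa using hi)] with ε hε
      simpa using hε.le
  have e2 : ∀ᶠ ε in nhdsWithin (0 : ℝ) (Set.Ioi 0), ∀ S : Finset N,
      ∑ i ∈ S, (g + ε • w) i ≤ h S := by
    refine Filter.eventually_all.2 fun S => ?_
    have hsum : ∀ ε : ℝ, ∑ i ∈ S, (g + ε • w) i = ∑ i ∈ S, g i + ε * ∑ i ∈ S, w i := by
      intro ε
      simp [Finset.sum_add_distrib, Finset.mul_sum]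
    simp only [hsum]
    rcases (hg.2 S).eq_or_lt with hi | hi
    · filter_upwards [hpos] with ε hε
      have := mul_nonpos_of_nonneg_of_nonpos hε.le (hw S hi)
      linarith
    · have hc : Filter.Tendsto (fun ε : ℝ => ∑ i ∈ S, g i + ε * ∑ i ∈ S, w i)
          (nhdsWithin 0 (Set.Ioi 0)) (nhds (∑ i ∈ S, g i + 0 * ∑ i ∈ S, w i)) :=
        ((by fun_prop : Continuous fun ε : ℝ => ∑ i ∈ S, g i + ε * ∑ i ∈ S, w i).tendsto
          0).mono_left nhdsWithin_le_nhds
      filter_upwards [hc.eventually_lt_const (u := h S) (by simpa using hi)] with ε hε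
      exact hε.le
  filter_upwards [e1, e2] with ε a b using ⟨a, b⟩

/-- First-order optimality for the squared distance to the constant vector `M`. -/
lemma sum_mul_nonpos_of_isMinOn [Fintype N] {Q : Set (N → ℝ)} {M : ℝ} {g w : N → ℝ}
    (hmin : ∀ x ∈ Q, ∑ i, (M - g i) ^ 2 ≤ ∑ i, (M - x i) ^ 2)
    (hw : ∀ᶠ ε in nhdsWithin (0 : ℝ) (Set.Ioi 0), g + ε • w ∈ Q) :
    ∑ i, (M - g i) * w i ≤ 0 := by
  have hpos : ∀ᶠ ε in nhdsWithin (0 : ℝ) (Set.Ioi 0), 0 < ε := eventually_mem_nhdsWithin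
  have key : ∀ᶠ ε in nhdsWithin (0 : ℝ) (Set.Ioi 0),
      ∑ i, (M - g i) * w i ≤ ε * ((∑ i, w i ^ 2) / 2) := by
    filter_upwards [hpos, hw] with ε hε hm
    have h1 := hmin _ hm
    have h2 : ∑ i, (M - (g + ε • w) i) ^ 2
        = ∑ i, (M - g i) ^ 2 - 2 * ε * ∑ i, (M - g i) * w i + ε ^ 2 * ∑ i, w i ^ 2 := by
      rw [Finset.mul_sum, Finset.mul_sum, ← Finset.sum_sub_distrib, ← Finset.sum_add_distrib]
      refine Finset.sum_congr rfl fun i _ => ?_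
      simp only [Pi.add_apply, Pi.smul_apply, smul_eq_mul]
      ring
    -- Half of the minimality inequality; cancelling `ε` leaves an upper bound that tends to 0.
    have h3 : 0 ≤ ε * (ε * ((∑ i, w i ^ 2) / 2) - ∑ i, (M - g i) * w i) := by nlinarith
    have := nonneg_of_mul_nonneg_right h3 hε
    linarith
  have hc : Filter.Tendsto (fun ε : ℝ => ε * ((∑ i, w i ^ 2) / 2)) (nhdsWithin 0 (Set.Ioi 0))
      (nhds (0 * ((∑ i, w i ^ 2) / 2))) :=
    ((by fun_prop : Continuous fun ε : ℝ => ε * ((∑ i, w i ^ 2) / 2)).tendsto 0).mono_left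
      nhdsWithin_le_nhds
  rw [zero_mul] at hc
  exact ge_of_tendsto hc key

section Tight

variable {h : Finset N → ℝ} {g : N → ℝ}

/-- Submodularity leaves no slack: the two bounds h(S ∩ T) and h(S ∪ T) add up to at most the total
that g attains on both sets. -/
lemma tight_inter_union [DecidableEq N]
    (hsub : IsSubmodular h) (hg : g ∈ polymatroid h) {S T : Finset N}
    (hS : ∑ i ∈ S, g i = h S) (hT : ∑ i ∈ T, g i = h T) :
    ∑ i ∈ S ∩ T, g i = h (S ∩ T) ∧ ∑ i ∈ S ∪ T, g i = h (S ∪ T) := by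
  have h1 := hsub S T
  have h2 := hg.2 (S ∩ T)
  have h3 := hg.2 (S ∪ T)
  have h4 := Finset.sum_union_inter (s₁ := S) (s₂ := T) (f := g)
  constructor <;> linarith

/-- If every two elements inside and outside `L` are separated by a tight set, and every element
of `L` lies in a tight set, then `L` is tight. -/
lemma tight_of_separated [Fintype N] [DecidableEq N]
    (hsub : IsSubmodular h) (h0 : h ∅ = 0) (hg : g ∈ polymatroid h)
    (L : Finset N) (huniv : ∑ i, g i = h univ)
    (hsep : ∀ i ∈ L, ∀ j ∉ L, ∃ S : Finset N, ∑ k ∈ S, g k = h S ∧ i ∈ S ∧ j ∉ S) :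
    ∑ i ∈ L, g i = h L := by
  -- Intersect the sets separating `i` from each `j ∉ L`; the union of the results over `i ∈ L` is
  -- then `L`.
  have hA : ∀ i ∈ L, ∃ S : Finset N, ∑ k ∈ S, g k = h S ∧ i ∈ S ∧ S ⊆ L := by
    intro i hi
    have : ∀ J : Finset N, J ⊆ Lᶜ → ∃ S : Finset N, ∑ k ∈ S, g k = h S ∧ i ∈ S ∧
        Disjoint S J := by
      intro J
      induction J using Finset.induction_on with
      | empty => exact fun _ => ⟨univ, huniv, by simp, by simp⟩
      | insert j J hj ih =>
        intro hJ
        obtain ⟨S, h1, h2, h3⟩ := ih ((Finset.subset_insert _ _).trans hJ)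
        obtain ⟨T, h4, h5, h6⟩ := hsep i hi j (by simpa using hJ (Finset.mem_insert_self j J))
        refine ⟨S ∩ T, (tight_inter_union hsub hg h1 h4).1, by simp [h2, h5], ?_⟩
        rw [Finset.disjoint_insert_right]
        exact ⟨by simp [h6], h3.mono_left Finset.inter_subset_left⟩
    obtain ⟨S, h1, h2, h3⟩ := this Lᶜ subset_rfl
    exact ⟨S, h1, h2, disjoint_compl_right_iff.1 h3⟩
  have : ∀ K : Finset N, K ⊆ L → ∃ S : Finset N, ∑ k ∈ S, g k = h S ∧ K ⊆ S ∧ S ⊆ L := by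
    intro K
    induction K using Finset.induction_on with
    | empty => exact fun _ => ⟨∅, by simp [h0], by simp, by simp⟩
    | insert i K hi ih =>
      intro hK
      obtain ⟨S, h1, h2, h3⟩ := ih ((Finset.subset_insert _ _).trans hK)
      obtain ⟨T, h4, h5, h6⟩ := hA i (hK (Finset.mem_insert_self i K))
      refine ⟨S ∪ T, (tight_inter_union hsub hg h1 h4).2, ?_, Finset.union_subset h3 h6⟩
      exact Finset.insert_subset (by simp [h5]) (h2.trans Finset.subset_union_left)
  obtain ⟨S, h1, h2, h3⟩ := this L subset_rfl
  rwa [h3.antisymm h2] at h1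

/-- If every element lies in a tight set, then the whole set is tight. -/
lemma tight_univ [Fintype N] [DecidableEq N]
    (hsub : IsSubmodular h) (h0 : h ∅ = 0) (hg : g ∈ polymatroid h)
    (hcov : ∀ i, ∃ S : Finset N, ∑ k ∈ S, g k = h S ∧ i ∈ S) : ∑ i, g i = h univ := by
  have : ∀ K : Finset N, ∃ S : Finset N, ∑ k ∈ S, g k = h S ∧ K ⊆ S := by
    intro K
    induction K using Finset.induction_on with
    | empty => exact ⟨∅, by simp [h0], by simp⟩
    | insert i K hi ih =>
      obtain ⟨S, h1, h2⟩ := ih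
      obtain ⟨T, h4, h5⟩ := hcov i
      exact ⟨S ∪ T, (tight_inter_union hsub hg h1 h4).2,
        Finset.insert_subset (by simp [h5]) (h2.trans Finset.subset_union_left)⟩
  obtain ⟨S, h1, h2⟩ := this univ
  rwa [Finset.univ_subset_iff.1 h2] at h1

end Tight

/-- The base of a polymatroid has a point all of whose lower level sets are tight, and this point
is its strict least-squares element. -/
theorem exists_egalitarian_base [Fintype N] [DecidableEq N] {h : Finset N → ℝ}
    (hsub : IsSubmodular h) (h0 : h ∅ = 0)
    (hnn : ∀ S, 0 ≤ h S) :
    ∃ g ∈ polymatroid h, ∑ i, g i = h univ ∧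
      (∀ c : ℝ, ∑ i with g i ≤ c, g i = h (univ.filter fun i => g i ≤ c)) ∧
      ∀ x ∈ polymatroid h, ∑ i, x i = h univ →
        ∑ i, g i ^ 2 + ∑ i, (x i - g i) ^ 2 ≤ ∑ i, x i ^ 2 := by
  -- `M` exceeds every feasible coordinate, so the objective rewards raising any coordinate and its
  -- minimizer lies on the base.
  set M : ℝ := ∑ i, h {i} + 1 with hM
  have hMi : ∀ i, h {i} < M := fun i => by
    have := Finset.single_le_sum (f := fun i => h {i}) (fun j _ => hnn {j}) (Finset.mem_univ i)
    linarith
  obtain ⟨g, hg, hmin⟩ := (isCompact_polymatroid h).exists_isMinOn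
    ⟨0, fun i => le_rfl, fun S => by simpa using hnn S⟩
    (f := fun x : N → ℝ => ∑ i, (M - x i) ^ 2) (by fun_prop)
  have hmin' : ∀ x ∈ polymatroid h, ∑ i, (M - g i) ^ 2 ≤ ∑ i, (M - x i) ^ 2 :=
    fun x hx => hmin hx
  have hcov : ∀ i, ∃ S : Finset N, ∑ k ∈ S, g k = h S ∧ i ∈ S := by
    intro i
    by_contra! hcon
    have := sum_mul_nonpos_of_isMinOn hmin' (eventually_add_smul_mem_polymatroid hg
      (w := Pi.single i 1) (fun j _ => by by_cases hj : j = i <;> simp [hj])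
      (fun S hS => by simp [Pi.single_apply, hcon S hS]))
    have h2 : g i ≤ h {i} := by simpa using hg.2 {i}
    have h3 := hMi i
    simp [Pi.single_apply] at this
    linarith
  have huniv := tight_univ hsub h0 hg hcov
  refine ⟨g, hg, huniv, fun c => ?_, fun x hx hxs => ?_⟩
  · refine tight_of_separated hsub h0 hg _ huniv fun i hi j hj => ?_
    simp only [Finset.mem_filter, Finset.mem_univ, true_and, not_le] at hi hj
    have hij : g i < g j := hi.trans_lt hj
    by_contra! hcon
    have hne : j ≠ i := by rintro rfl; exact hij.false
    -- Without a separating tight set, a transfer from `j` to `i` is feasible: `g j > g i ≥ 0`, and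
    -- every tight set containing `i` also contains `j`. It would bring the vector closer to `M`.
    have := sum_mul_nonpos_of_isMinOn hmin' (eventually_add_smul_mem_polymatroid hg
      (w := Pi.single i 1 - Pi.single j 1)
      (fun k hk => by
        have hkj : k ≠ j := by
          rintro rfl
          have := hg.1 i
          linarith
        by_cases hki : k = i <;> simp [hki, hkj, hne.symm])
      (fun S hS => by
        have := hcon S hS
        by_cases hiS : i ∈ S
        · simp [Pi.single_apply, hiS, this hiS]
        · by_cases hjS : j ∈ S <;> simp [Pi.single_apply, hiS, hjS]))
    simp [Pi.single_apply, mul_sub, Finset.sum_sub_distrib] at this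
    linarith
  -- Moving towards `x` is feasible; since the totals agree, `M` drops out and first-order
  -- optimality reads ∑ g i (x i − g i) ≥ 0.
  · have hconv : ∀ᶠ ε in nhdsWithin (0 : ℝ) (Set.Ioi 0), g + ε • (x - g) ∈ polymatroid h := by
      refine eventually_add_smul_mem_polymatroid hg (fun i hi => ?_) (fun S hS => ?_)
      · simpa [hi] using hx.1 i
      · have := hx.2 S
        simp only [Pi.sub_apply, Finset.sum_sub_distrib]
        linarith
    have h1 := sum_mul_nonpos_of_isMinOn hmin' hconv
    have h2 : ∑ i, (M - g i) * (x - g) i = M * (∑ i, x i - ∑ i, g i) - ∑ i, g i * (x i - g i) := by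
      rw [← Finset.sum_sub_distrib, Finset.mul_sum, ← Finset.sum_sub_distrib]
      exact Finset.sum_congr rfl fun i _ => by simp only [Pi.sub_apply]; ring
    have h3 : ∑ i, x i ^ 2 = ∑ i, g i ^ 2 + ∑ i, (x i - g i) ^ 2 + 2 * ∑ i, g i * (x i - g i) := by
      rw [Finset.mul_sum, ← Finset.sum_add_distrib, ← Finset.sum_add_distrib]
      exact Finset.sum_congr rfl fun i _ => by ring
    rw [huniv, hxs, sub_self, mul_zero] at h2
    linarith

end Polymatroid

/-! ### Rearrangements, Lorenz dominance and the lexicographic order. -/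

section Sorted

variable {n : ℕ}

lemma sum_sorted (x : Fin n → ℝ) (φ : ℝ → ℝ) : ∑ i, φ (sorted x i) = ∑ i, φ (x i) :=
  Equiv.sum_comp (Tuple.sort x) (fun i => φ (x i))

lemma monotone_sorted (x : Fin n → ℝ) : Monotone (sorted x) := Tuple.monotone_sort x

lemma card_filter_val_lt {k : ℕ} (hk : k ≤ n) :
    (univ.filter fun i : Fin n => i.val < k).card = k := by
  rw [Fin.card_filter_val_lt, min_eq_right hk]

/-- One half of the duality: the sum of the k smallest coordinates is the maximum over c of kc − ∑
(c − x i)⁺. It turns Lorenz dominance into a comparison free of sorting. -/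
lemma sub_le_sum_sorted (x : Fin n → ℝ) {k : ℕ} (hk : k ≤ n) (c : ℝ) :
    k * c - ∑ i, max (c - x i) 0 ≤ ∑ i : Fin n with i.val < k, sorted x i := by
  have h1 : ∑ i : Fin n with i.val < k, (c - sorted x i) ≤ ∑ i, max (c - sorted x i) 0 :=
    (Finset.sum_le_sum fun i _ => le_max_left _ _).trans
      (Finset.sum_le_sum_of_subset_of_nonneg (Finset.filter_subset _ _)
        fun i _ _ => le_max_right _ _)
  rw [sum_sorted x (fun t => max (c - t) 0), Finset.sum_sub_distrib, Finset.sum_const,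
    card_filter_val_lt hk, nsmul_eq_mul] at h1
  linarith

lemma exists_sum_sorted_eq (x : Fin n → ℝ) {k : ℕ} (hk1 : 1 ≤ k) (hk : k ≤ n) :
    ∃ c : ℝ, ∑ i : Fin n with i.val < k, sorted x i = k * c - ∑ i, max (c - x i) 0 := by
  -- The maximum is attained at the `k`-th smallest coordinate, which has index `k - 1`.
  set m : Fin n := ⟨k - 1, by omega⟩
  refine ⟨sorted x m, ?_⟩
  rw [← sum_sorted x (fun t => max (sorted x m - t) 0)]
  have h1 : ∑ i, max (sorted x m - sorted x i) 0
      = ∑ i : Fin n with i.val < k, (sorted x m - sorted x i) := by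
    rw [Finset.sum_filter]
    refine Finset.sum_congr rfl fun i _ => ?_
    split_ifs with hi
    · exact max_eq_left (sub_nonneg.2 (monotone_sorted x (Fin.le_def.2 (by simp [m]; omega))))
    · exact max_eq_right (sub_nonpos.2 (monotone_sorted x (Fin.le_def.2 (by simp [m]; omega))))
  rw [h1, Finset.sum_sub_distrib, Finset.sum_const, card_filter_val_lt hk, nsmul_eq_mul]
  ring

lemma lorenzDominates_of_sum_max_le {x y : Fin n → ℝ} (hs : ∑ i, x i = ∑ i, y i)
    (h : ∀ c : ℝ, ∑ i, max (c - x i) 0 ≤ ∑ i, max (c - y i) 0) : LorenzDominates x y := by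
  refine ⟨hs, fun k hk1 hk => ?_⟩
  obtain ⟨c, hc⟩ := exists_sum_sorted_eq y hk1 hk
  have := sub_le_sum_sorted x hk c
  have := h c
  linarith

lemma sum_filter_val_lt_succ (y : Fin n → ℝ) (k : Fin n) :
    ∑ i : Fin n with i.val < k.val + 1, y i = ∑ i : Fin n with i.val < k.val, y i + y k := by
  have : (univ.filter fun i : Fin n => i.val < k.val + 1)
      = insert k (univ.filter fun i : Fin n => i.val < k.val) := by
    ext i
    simp only [Finset.mem_filter, Finset.mem_univ, true_and, Finset.mem_insert, Fin.ext_iff]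
    omega
  rw [this, Finset.sum_insert (by simp), add_comm]

/-- At the first difference of the rearrangements, the Lorenz-dominating vector is larger. -/
lemma LorenzDominates.lexGreater {x y : Fin n → ℝ} (h : LorenzDominates x y)
    (hne : sorted x ≠ sorted y) : LexGreater x y := by
  classical
  have hex : ∃ k : Fin n, sorted x k ≠ sorted y k := Function.ne_iff.1 hne
  obtain ⟨k, hk, hmin⟩ := WellFounded.has_min (r := ((· < ·) : Fin n → Fin n → Prop))
    wellFounded_lt {k | sorted x k ≠ sorted y k} hex
  have heq : ∀ i < k, sorted x i = sorted y i := fun i hi => by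
    by_contra hc
    exact hmin i hc hi
  have hpre : ∑ i : Fin n with i.val < k.val, sorted x i
      = ∑ i : Fin n with i.val < k.val, sorted y i :=
    Finset.sum_congr rfl fun i hi => heq i (by simpa using hi)
  have h1 := h.2 (k.val + 1) (by omega) k.isLt
  rw [sum_filter_val_lt_succ, sum_filter_val_lt_succ, hpre] at h1
  have hlt : sorted y k < sorted x k := lt_of_le_of_ne (by linarith) (Ne.symm hk)
  refine ⟨h.1, k, ?_, hlt, heq⟩
  -- At the last index, equal totals and equal earlier entries would force equality there.
  by_contra hlast
  have hall : ∀ z : Fin n → ℝ, ∑ i : Fin n with i.val < k.val + 1, z i = ∑ i, z i := fun z => by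
    rw [Finset.filter_true_of_mem]
    intro i _
    omega
  have h2 := sum_sorted x id
  have h3 := sum_sorted y id
  simp only [id] at h2 h3
  rw [← hall, sum_filter_val_lt_succ, hpre] at h2
  rw [← hall, sum_filter_val_lt_succ] at h3
  linarith [h.1]

lemma LexGreater.asymm {x y : Fin n → ℝ} (h : LexGreater x y) : ¬ LexGreater y x := by
  obtain ⟨-, k, -, hk, hke⟩ := h
  rintro ⟨-, l, -, hl, hle⟩
  rcases lt_trichotomy k l with hkl | rfl | hkl
  · exact hk.ne (hle k hkl)
  · exact hk.asymm hl
  · exact hl.ne (hke l hkl)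

lemma LorenzDominates.sorted_eq {x y : Fin n → ℝ} (h : LorenzDominates x y)
    (h' : LorenzDominates y x) : sorted x = sorted y := by
  by_contra hne
  exact (h.lexGreater hne).asymm (h'.lexGreater (Ne.symm hne))

/-- A vector with tight lower level sets Lorenz-dominates the base of a polymatroid. -/
lemma lorenzDominates_of_tight {h : Finset (Fin n) → ℝ} {g x : Fin n → ℝ}
    (hs : ∑ i, g i = ∑ i, x i) (hx : x ∈ polymatroid h)
    (hg : ∀ c : ℝ, ∑ i with g i ≤ c, g i = h (univ.filter fun i => g i ≤ c)) :
    LorenzDominates g x := by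
  refine lorenzDominates_of_sum_max_le hs fun c => ?_
  calc ∑ i, max (c - g i) 0 = ∑ i with g i ≤ c, (c - g i) := by
        rw [Finset.sum_filter]
        refine Finset.sum_congr rfl fun i _ => ?_
        split_ifs with hi
        · exact max_eq_left (by linarith)
        · exact max_eq_right (by linarith)
    _ ≤ ∑ i with g i ≤ c, (c - x i) := by
        rw [Finset.sum_sub_distrib, Finset.sum_sub_distrib, hg c]
        linarith [hx.2 (univ.filter fun i => g i ≤ c)]
    _ ≤ ∑ i with g i ≤ c, max (c - x i) 0 := Finset.sum_le_sum fun i _ => le_max_left _ _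
    _ ≤ ∑ i, max (c - x i) 0 :=
        Finset.sum_le_sum_of_subset_of_nonneg (Finset.filter_subset _ _)
          fun i _ _ => le_max_right _ _

end Sorted

/-! ### The WS-core as the base of the excess polymatroid. -/

section Core

variable {n : ℕ} {Alt : Type*} [Fintype Alt] {v : Fin n → Alt → ℝ} {π : Alt → ℝ}

lemma gain_eq_iff {s t : Solution v} : gain π s = gain π t ↔ s.utility = t.utility := by
  simp only [funext_iff, gain, sub_left_inj]

variable [Nonempty Alt]

/-- The maximum welfare of a set of agents in excess of its disagreement utility. -/
noncomputable def excess (v : Fin n → Alt → ℝ) (π : Alt → ℝ) (S : Finset (Fin n)) : ℝ :=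
  wmax v S - ∑ i ∈ S, disagreement v π i

lemma wmax_empty (v : Fin n → Alt → ℝ) : wmax v ∅ = 0 := by
  obtain ⟨A, hA⟩ := exists_sum_eq_wmax v ∅
  simpa using hA.symm

lemma sum_disagreement_le_wmax (v : Fin n → Alt → ℝ) (hπ : π ∈ stdSimplex ℝ Alt)
    (S : Finset (Fin n)) : ∑ i ∈ S, disagreement v π i ≤ wmax v S := by
  calc ∑ i ∈ S, disagreement v π i = ∑ A, π A * ∑ i ∈ S, v i A := by
        simp only [disagreement, Finset.mul_sum]
        exact Finset.sum_comm
    _ ≤ ∑ A, π A * wmax v S :=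
        Finset.sum_le_sum fun A _ => mul_le_mul_of_nonneg_left (sum_le_wmax v S A) (hπ.1 A)
    _ = wmax v S := by rw [← Finset.sum_mul, hπ.2, one_mul]

lemma IsSubmodular.excess (hsub : IsSubmodular (wmax v)) (π : Alt → ℝ) :
    IsSubmodular (excess v π) := by
  intro S T
  have h1 := hsub S T
  have h2 := Finset.sum_union_inter (s₁ := S) (s₂ := T) (f := disagreement v π)
  simp only [WelfareSharing.excess]
  linarith

lemma Solution.sum_utility (s : Solution v) : ∑ i, s.utility i = wmax v univ := by
  obtain ⟨A, hA⟩ := exists_sum_eq_wmax v univ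
  simp only [Solution.utility, Finset.sum_add_distrib, s.budget_balanced, add_zero]
  exact le_antisymm (sum_le_wmax v univ s.alt) (hA ▸ s.welfare_max A)

lemma sum_gain (π : Alt → ℝ) (s : Solution v) : ∑ i, gain π s i = excess v π univ := by
  simp only [gain, Finset.sum_sub_distrib, s.sum_utility, excess]

lemma mem_wsCore_iff {s : Solution v} : s ∈ wsCore v π ↔ gain π s ∈ polymatroid (excess v π) := by
  simp only [wsCore, polymatroid, gain, excess, Set.mem_ofPred_eq, sub_nonneg,
    Finset.sum_sub_distrib, sub_le_sub_iff_right]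

lemma exists_solution_gain_eq (v : Fin n → Alt → ℝ) (π : Alt → ℝ) {g : Fin n → ℝ}
    (hg : ∑ i, g i = excess v π univ) : ∃ s : Solution v, gain π s = g := by
  obtain ⟨A, hA⟩ := exists_sum_eq_wmax v univ
  -- These transfers are forced by the prescribed gains; they balance because `g` sums to the total
  -- excess.
  refine ⟨⟨A, fun i => g i + disagreement v π i - v i A, fun B => ?_, ?_⟩, ?_⟩
  · rw [hA]
    exact sum_le_wmax v univ B
  · rw [Finset.sum_sub_distrib, Finset.sum_add_distrib, hg, hA, excess]
    ring
  · funext i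
    simp only [gain, Solution.utility]
    ring

/-- With a submodular maximum welfare, the WS-core has a Lorenz-dominating solution, and it is the
only Lorenz-dominating, the only lexicographically maximal and the only min-square one. -/
theorem exists_lorenz_lexmax_minSquare (hsub : IsSubmodular (wmax v)) (hπ : π ∈ stdSimplex ℝ Alt) :
    ∃ u : Fin n → ℝ, (∃ s ∈ wsCore v π, s.utility = u) ∧
      ∀ s ∈ wsCore v π, (IsLorenzDominating π s ↔ s.utility = u) ∧
        (IsLexmaxWS π s ↔ s.utility = u) ∧ (IsMinSquare π s ↔ s.utility = u) := by
  obtain ⟨g, hg, hgs, htight, hsq⟩ := exists_egalitarian_base (hsub.excess π)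
    (by simp [excess, wmax_empty]) (fun S => sub_nonneg.2 (sum_disagreement_le_wmax v hπ S))
  obtain ⟨s₀, rfl⟩ := exists_solution_gain_eq v π hgs
  have hdom : ∀ t ∈ wsCore v π, LorenzDominates (gain π s₀) (gain π t) := fun t ht =>
    lorenzDominates_of_tight ((sum_gain π s₀).trans (sum_gain π t).symm) (mem_wsCore_iff.1 ht)
      htight
  have hsq' : ∀ t ∈ wsCore v π, ∑ i, gain π s₀ i ^ 2 + ∑ i, (gain π t i - gain π s₀ i) ^ 2
      ≤ ∑ i, gain π t i ^ 2 := fun t ht => hsq _ (mem_wsCore_iff.1 ht) (sum_gain π t)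
  have hmin : ∀ t ∈ wsCore v π, ∑ i, gain π t i ^ 2 ≤ ∑ i, gain π s₀ i ^ 2 →
      t.utility = s₀.utility := by
    intro t ht hle
    refine (gain_eq_iff (π := π)).1 (funext fun i => ?_)
    have hz : ∑ i, (gain π t i - gain π s₀ i) ^ 2 = 0 :=
      le_antisymm (by linarith [hsq' t ht]) (Finset.sum_nonneg fun i _ => sq_nonneg _)
    rw [Finset.sum_eq_zero_iff_of_nonneg fun i _ => sq_nonneg _] at hz
    exact sub_eq_zero.1 (pow_eq_zero_iff (two_ne_zero) |>.1 (hz i (Finset.mem_univ i)))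
  have hsort : ∀ t ∈ wsCore v π, sorted (gain π s₀) = sorted (gain π t) →
      t.utility = s₀.utility := by
    intro t ht he
    refine hmin t ht (le_of_eq ?_)
    rw [← sum_sorted (gain π t) (fun r => r ^ 2), ← sum_sorted (gain π s₀) (fun r => r ^ 2), he]
  have hs₀ : s₀ ∈ wsCore v π := mem_wsCore_iff.2 hg
  refine ⟨s₀.utility, ⟨s₀, hs₀, rfl⟩, fun s hs => ⟨⟨fun h => ?_, fun h => ?_⟩,
    ⟨fun h => ?_, fun h => ?_⟩, ⟨fun h => ?_, fun h => ?_⟩⟩⟩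
  · exact hsort s hs ((hdom s hs).sorted_eq (h.2 s₀ hs₀))
  · rw [← gain_eq_iff (π := π)] at h
    exact ⟨hs, h ▸ hdom⟩
  · by_contra hne
    exact (h.2 s₀ hs₀ (Ne.symm hne)).asymm
      ((hdom s hs).lexGreater fun he => hne (hsort s hs he))
  · refine ⟨hs, fun t ht hne => ?_⟩
    rw [h] at hne
    rw [gain_eq_iff.2 h]
    exact (hdom t ht).lexGreater fun he => hne (hsort t ht he)
  · exact hmin s hs (h.2 s₀ hs₀)
  · refine ⟨hs, fun t ht => ?_⟩
    rw [gain_eq_iff.2 h]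
    have : 0 ≤ ∑ i, (gain π t i - gain π s₀ i) ^ 2 := Finset.sum_nonneg fun i _ => sq_nonneg _
    linarith [hsq' t ht]

end Core

end WelfareSharing

theorem mainTheorem5 (n : ℕ) (val : Fin n → Fin n → ℝ) :
    -- `wmax` of a set of agents is its maximum-weight matching value, and it is submodular
    (∀ S : Finset (Fin n),
      IsGreatest (Set.range fun f : S ↪ Fin n => ∑ i : S, val i (f i))
        (WelfareSharing.wmax (WelfareSharing.unitDemand val) S)) ∧
    WelfareSharing.IsSubmodular (WelfareSharing.wmax (WelfareSharing.unitDemand val)) ∧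
    -- for every disagreement distribution, one utility vector is attained in the WS-core, and it
    -- characterizes each of the three kinds of solutions
    ∀ π ∈ stdSimplex ℝ (Equiv.Perm (Fin n)),
      ∃ u : Fin n → ℝ,
        (∃ s ∈ WelfareSharing.wsCore (WelfareSharing.unitDemand val) π, s.utility = u) ∧
        ∀ s ∈ WelfareSharing.wsCore (WelfareSharing.unitDemand val) π,
          (WelfareSharing.IsLorenzDominating π s ↔ s.utility = u) ∧
          (WelfareSharing.IsLexmaxWS π s ↔ s.utility = u) ∧
          (WelfareSharing.IsMinSquare π s ↔ s.utility = u) := by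
  exact ⟨WelfareSharing.isGreatest_wmax_unitDemand val,
    WelfareSharing.isSubmodular_wmax_unitDemand val, fun _ hπ =>
      WelfareSharing.exists_lorenz_lexmax_minSquare
        (WelfareSharing.isSubmodular_wmax_unitDemand val) hπ⟩
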